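/- Let $n\ge k\ge 2$. A parking function of length $n$ is a tuple $(a_1,\dots,a_n)$ of positive integers whose weakly increasing rearrangement $b_1\le\dots\le b_n$ satisfies $b_i\le i$ for all $i$; let $\mathrm{PF}_{n,k}$ be the set of parking functions of length $n$ in which $k$ does not occur but each of $k+1,\dots,n$ occurs. Let $\mathrm{NC}_{n+1}$ be the lattice of noncrossing partitions of $\{1,\dots,n+1\}$, ordered by refinement. Label a covering relation $\sigma<\tau$ of $\mathrm{NC}_{n+1}$, in which blocks $B_1,B_2$ of $\sigma$ are merged to a block $B=B_1\cup B_2$ of $\tau$ with $\min B\in B_1$, by the largest element of $B_1$ that is smaller than all elements of $B_2$. Reading labels from bottom to top assigns to every maximal chain of $\mathrm{NC}_{n+1}$ a parking function of length $n$. Let $\mathrm{Poset}(\mathrm{PF}_{n,k})$ be the poset whose Hasse diagram is the union of the maximal chains of $\mathrm{NC}_{n+1}$ whose label sequence lies in $\mathrm{PF}_{n,k}$; that is, its elements are the partitions on these chains, and its order is the reflexive-transitive closure of the relation of being consecutive, lower to upper, on one of these chains. Theorem. For all $n\ge k\ge 2$, the poset $\mathrm{Poset}(\mathrm{PF}_{n,k})$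 has a minimum $\hat 0$ and a maximum $\hat 1$ (the minimum and maximum of $\mathrm{NC}_{n+1}$), and its Möbius function satisfies $\mu(\hat 0,\hat 1)=0$. -/

import Mathlib

/-! Parking functions, noncrossing partitions, the labelled maximal chains of the noncrossing
partition lattice, and the posets spanned by the chains of a class of parking functions. -/

/-- `a` is a parking function of length `n`: a tuple of positive integers whose weakly increasing
rearrangement has its `i`th entry at most `i` (positions are counted from `0` here). -/
def IsParkingFunction {n : ℕ} (a : Fin n → ℕ) : Prop :=
  (∀ i, 1 ≤ a i) ∧
    ∃ σ : Equiv.Perm (Fin n), Monotone (fun i => a (σ i)) ∧ ∀ i : Fin n, a (σ i) ≤ (i : ℕ) + 1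

/-- `PF n k`: the parking functions of length `n` for which `k` is the largest missing number. -/
def PF (n k : ℕ) : Set (Fin n → ℕ) :=
  {a | IsParkingFunction a ∧ (∀ i, a i ≠ k) ∧ ∀ j, k < j → j ≤ n → ∃ i, a i = j}

/-- A partition of `m` points arranged in cyclic order is noncrossing: no two elements
`a < c` of a block are separated by elements `b < d` of another block with `a < b < c < d`. -/
def IsNoncrossing {m : ℕ} (s : Setoid (Fin m)) : Prop :=
  ∀ a b c d : Fin m, a < b → b < c → c < d → s a c → s b d → s a b

/-- The noncrossing partition lattice of an `m`-element set, ordered by refinement. The element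
`x : Fin m` stands for the number `x + 1` of `{1, …, m}`. -/
abbrev NC (m : ℕ) : Type := {s : Setoid (Fin m) // IsNoncrossing s}

instance instBoundedOrderNC (m : ℕ) : BoundedOrder (NC m) where
  bot := ⟨⊥, fun a _ c _ hab hbc _ h _ => absurd (show a = c from h) (hab.trans hbc).ne⟩
  bot_le x := show (⊥ : Setoid (Fin m)) ≤ x.1 from bot_le
  top := ⟨⊤, fun _ _ _ _ _ _ _ _ _ => trivial⟩
  le_top x := show x.1 ≤ (⊤ : Setoid (Fin m)) from le_top

/-- `IsEdgeLabel σ τ l`: a block `B` of `τ` is the union of two blocks `B₁ ≠ B₂` of `σ`, where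
`B₁` contains `min B`, and `l` is the largest number in `B₁` that is less than all elements
of `B₂`. For a covering relation `σ ⋖ τ` there is exactly one such `l`. -/
def IsEdgeLabel {m : ℕ} (σ τ : NC m) (l : ℕ) : Prop :=
  ∃ B₁ ∈ σ.1.classes, ∃ B₂ ∈ σ.1.classes, B₁ ≠ B₂ ∧ B₁ ∪ B₂ ∈ τ.1.classes ∧
    (∃ x ∈ B₁, IsLeast (B₁ ∪ B₂) x) ∧
    ∃ x : Fin m, IsGreatest {z | z ∈ B₁ ∧ ∀ y ∈ B₂, z < y} x ∧ l = (x : ℕ) + 1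

/-- A maximal chain of `NC (n + 1)`, as a path from bottom to top in the Hasse diagram. -/
def IsMaximalChain {n : ℕ} (c : Fin (n + 1) → NC (n + 1)) : Prop :=
  c 0 = ⊥ ∧ c (Fin.last n) = ⊤ ∧ ∀ i : Fin n, c i.castSucc ⋖ c i.succ

/-- The maximal chains of `NC (n + 1)` whose sequence of edge labels, read from bottom to top,
belongs to `PF n k`. -/
def chainsPF (n k : ℕ) : Set (Fin (n + 1) → NC (n + 1)) :=
  {c | IsMaximalChain c ∧ ∃ a ∈ PF n k, ∀ i : Fin n, IsEdgeLabel (c i.castSucc) (c i.succ) (a i)}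

/-- The elements of the poset of `PF n k`: the noncrossing partitions on one of the chains. -/
def PosetPF (n k : ℕ) : Type :=
  {π : NC (n + 1) // ∃ c ∈ chainsPF n k, ∃ i, c i = π}

namespace PosetPF

/-- The edges of the Hasse diagram: consecutive elements of one of the chains. -/
def Edge {n k : ℕ} (x y : PosetPF n k) : Prop :=
  ∃ c ∈ chainsPF n k, ∃ i : Fin n, c i.castSucc = x.1 ∧ c i.succ = y.1

theorem le_of_reflTransGen {n k : ℕ} {x y : PosetPF n k}
    (h : Relation.ReflTransGen Edge x y) : x.1 ≤ y.1 := by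
  induction h with
  | refl => exact le_rfl
  | tail _ hbc ih =>
    obtain ⟨c, hc, i, h1, h2⟩ := hbc
    exact ih.trans (h1 ▸ h2 ▸ (hc.1.2.2 i).le)

/-- The order generated by the edges (not the order induced from `NC (n + 1)`). -/
instance instPartialOrder (n k : ℕ) : PartialOrder (PosetPF n k) where
  le := Relation.ReflTransGen Edge
  le_refl _ := Relation.ReflTransGen.refl
  le_trans _ _ _ := Relation.ReflTransGen.trans
  le_antisymm _ _ hxy hyx :=
    Subtype.ext (le_antisymm (le_of_reflTransGen hxy) (le_of_reflTransGen hyx))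

instance instFinite (n k : ℕ) : Finite (PosetPF n k) := by
  have : Finite (Setoid (Fin (n + 1))) :=
    Finite.of_injective (fun s : Setoid (Fin (n + 1)) => fun a b => s a b)
      (fun s t h => Setoid.ext fun a b => iff_of_eq (congrFun (congrFun h a) b))
  exact inferInstanceAs (Finite {π : NC (n + 1) // _})

noncomputable instance instDecidableEq (n k : ℕ) : DecidableEq (PosetPF n k) :=
  Classical.decEq _

open Classical in
noncomputable instance instLocallyFiniteOrder (n k : ℕ) : LocallyFiniteOrder (PosetPF n k) :=
  letI := Fintype.ofFinite (PosetPF n k)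
  Fintype.toLocallyFiniteOrder

end PosetPF

/-!
The vanishing of the Möbius function comes from a closure operator below each element that joins the
number `k` to a larger number, the maximum being one of these elements.

Counting how often two classes with elements above a given bound are united shows that the maximal
chains labelled by `PF n k` are exactly the maximal chains all of whose steps satisfy a condition on
the two united classes alone: the label is not `k`, and if both classes contain numbers above `k`,
then one lies entirely to the left of the other (`goodStep_of_mem_chainsPF`,
`mem_chainsPF_of_goodStep`). So the elements of the poset are the partitions that lie on a path of
good steps from the minimum to the maximum, and its order is reachability by good steps.

Let `y` be an element whose class `B` of `k` contains numbers above `k`, let `p` be the least element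
of `B` and `q` the least element of `B` above `k`. Uniting the classes of `p` and `q` is a closure
operator on the elements `x ≤ y`. Two facts make this work, both proved by descending along a path
of good steps that ends in `y`: a class of `x` in `B` that contains a number above `k`, but not `q`,
lies to the right of the class of `q` (`IsPivot.lt_of_not_rel_q`), and `x` cannot join `p` to `k`
before it joins `p` to `q`, since then the label `k` would occur (`IsPivot.rel_pq_of_rel_e`).
Consequently the union of the classes of `p` and `q` is noncrossing and reached by a good step, and
good steps are carried to good steps or equalities (`IsPivot.closure_step`).

By Rota's closure theorem the values `μ(0̂, x)`, summed over all `x ≤ y` with closure `y`, add up to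
zero. If such an `x` differs from `y`, then `B` is the union of the classes of `p` and `q` in `x`,
and the second fact puts `k` into the class of `q`. So `x` again joins `k` to a larger number, and
`μ(0̂, x) = 0` by induction; the only remaining term of the sum is `μ(0̂, y)`
(`PosetPF.mu_eq_zero`).
-/

/-! ### Merging two classes of an equivalence relation -/

namespace Setoid

variable {α : Type*}

/-- The equivalence relation obtained from `s` by uniting the classes of `u` and `v`. -/
def mergeClasses (s : Setoid α) (u v : α) : Setoid α where
  r a b := s a b ∨ (s a u ∨ s a v) ∧ (s b u ∨ s b v)
  iseqv :=
    { refl a := Or.inl (s.refl a)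
      symm h := h.imp s.symm fun h => ⟨h.2, h.1⟩
      trans := by
        rintro a b c (h | h) (h' | h')
        · exact Or.inl (s.trans h h')
        · exact Or.inr ⟨h'.1.imp (s.trans h) (s.trans h), h'.2⟩
        · exact Or.inr ⟨h.1, h.2.imp (s.trans (s.symm h')) (s.trans (s.symm h'))⟩
        · exact Or.inr ⟨h.1, h'.2⟩ }

theorem mergeClasses_apply {s : Setoid α} {u v a b : α} :
    s.mergeClasses u v a b ↔ s a b ∨ (s a u ∨ s a v) ∧ (s b u ∨ s b v) := Iff.rfl

theorem mergeClasses_pair (s : Setoid α) (u v : α) : s.mergeClasses u v u v :=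
  Or.inr ⟨Or.inl (s.refl u), Or.inr (s.refl v)⟩

theorem le_mergeClasses (s : Setoid α) (u v : α) : s ≤ s.mergeClasses u v := fun _ _ h => Or.inl h

theorem mergeClasses_le_iff {s t : Setoid α} {u v : α} :
    s.mergeClasses u v ≤ t ↔ s ≤ t ∧ t u v := by
  refine ⟨fun h => ⟨(s.le_mergeClasses u v).trans h, h (s.mergeClasses_pair u v)⟩, ?_⟩
  rintro ⟨h, huv⟩ a b (hab | ⟨ha, hb⟩)
  · exact h hab
  · have key : ∀ {c}, s c u ∨ s c v → t c u := fun hc =>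
      hc.elim (fun hc => h hc) fun hc => t.trans (h hc) (t.symm huv)
    exact t.trans (key ha) (t.symm (key hb))

theorem mergeClasses_comm (s : Setoid α) (u v : α) : s.mergeClasses u v = s.mergeClasses v u :=
  Setoid.ext fun a b => by simp only [mergeClasses_apply, or_comm]

theorem mergeClasses_eq_self {s : Setoid α} {u v : α} (h : s u v) : s.mergeClasses u v = s :=
  le_antisymm (mergeClasses_le_iff.2 ⟨le_rfl, h⟩) (s.le_mergeClasses u v)

end Setoid

/-! ### Good steps between noncrossing partitions -/

/-- The classes of `u` and `v` are distinct, the class of `u` contains an element below the class of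
`v`, and uniting them neither creates the label `k` (`exists_le`) nor violates the condition imposed
by each of the labels `k + 1, …, n` being used (`lt`): two classes that both contain numbers above
`k` may be united only if the lower one lies entirely to the left of the other. The element `a` of
`Fin m` stands for the number `a + 1`, so it is the number `k` if `a + 1 = k` and a number above `k`
if `k ≤ a`. In `exists_le` the lower class contains `k` and the upper one only numbers above `k`;
the label is then `k` unless the lower class also contains a number above `k`, which by `lt` is to
the left of the upper class. -/
structure IsGoodMerge {m : ℕ} (k : ℕ) (s : Setoid (Fin m)) (u v : Fin m) : Prop where
  not_rel : ¬ s u v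
  low : ∃ w, s w u ∧ ∀ b, s b v → w < b
  exists_le : ∀ e, s e u → (e : ℕ) + 1 = k → (∀ b, s b v → k ≤ (b : ℕ)) → ∃ a, s a u ∧ k ≤ (a : ℕ)
  lt : ∀ a b, s a u → s b v → k ≤ (a : ℕ) → k ≤ (b : ℕ) → ∀ a' b', s a' u → s b' v → a' < b'

/-- `y` arises from `x` by uniting two classes in a way that is allowed on the chains that make up
the poset of `PF n k`. -/
def GoodStep {m : ℕ} (k : ℕ) (x y : NC m) : Prop :=
  ∃ u v, IsGoodMerge k x.1 u v ∧ y.1 = x.1.mergeClasses u v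

/-- A composition of good steps. -/
abbrev GoodLE {m : ℕ} (k : ℕ) : NC m → NC m → Prop := Relation.ReflTransGen (GoodStep k)

section Good

variable {m k : ℕ}

theorem GoodStep.le {x y : NC m} (h : GoodStep k x y) : x ≤ y := by
  obtain ⟨u, v, -, h⟩ := h
  exact Subtype.coe_le_coe.1 (h ▸ x.1.le_mergeClasses u v)

theorem GoodLE.le {x y : NC m} (h : GoodLE k x y) : x ≤ y := by
  induction h with
  | refl => exact le_rfl
  | tail _ h ih => exact ih.trans h.le

/-! ### The closure operator below a partition -/

/-- The element `e` stands for the number `k`, `p` is the least element of its class in `y`, and `q`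
is the least element of this class that stands for a number above `k`. -/
structure IsPivot (k : ℕ) (y : NC m) (e p q : Fin m) : Prop where
  he : (e : ℕ) + 1 = k
  rel_p : y.1 p e
  p_le : ∀ a, y.1 a e → p ≤ a
  rel_q : y.1 q e
  k_le : k ≤ (q : ℕ)
  q_le : ∀ a, y.1 a e → k ≤ (a : ℕ) → q ≤ a

theorem exists_isPivot {y : NC m} {e t : Fin m} (he : (e : ℕ) + 1 = k) (ht : k ≤ (t : ℕ))
    (h : y.1 t e) : ∃ p q, IsPivot k y e p q := by
  obtain ⟨p, hp, hp'⟩ := exists_minimal_of_wellFoundedLT (fun a => y.1 a e) ⟨e, y.1.refl e⟩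
  obtain ⟨q, hq, hq'⟩ := exists_minimal_of_wellFoundedLT (fun a => y.1 a e ∧ k ≤ (a : ℕ)) ⟨t, h, ht⟩
  refine ⟨p, q, he, hp, fun a ha => ?_, hq.1, hq.2, fun a ha hk => ?_⟩
  · rcases le_total p a with h | h
    exacts [h, hp' ha h]
  · rcases le_total q a with h | h
    exacts [h, hq' ⟨ha, hk⟩ h]

namespace IsPivot

variable {y x x' : NC m} {e p q : Fin m}

theorem p_le_e (H : IsPivot k y e p q) : p ≤ e := H.p_le e (y.1.refl e)

theorem e_lt_q (H : IsPivot k y e p q) : e < q := by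
  have := H.he; have := H.k_le; exact Fin.lt_def.2 (by omega)

theorem p_lt_q (H : IsPivot k y e p q) : p < q := H.p_le_e.trans_lt H.e_lt_q

theorem rel_pq (H : IsPivot k y e p q) : y.1 p q := y.1.trans H.rel_p (y.1.symm H.rel_q)

/-- Below `y`, a class that contains a number above `k` but not `q` lies to the right of the class
of `q`: classes with numbers above `k` are only ever united with the lower one on the left. -/
theorem lt_of_not_rel_q (H : IsPivot k y e p q) (hx : GoodLE k x y) :
    ∀ b, y.1 b e → k ≤ (b : ℕ) → ¬ x.1 b q → ∀ c b', x.1 c q → x.1 b' b → c < b' := by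
  induction hx using Relation.ReflTransGen.head_induction_on with
  | refl => exact fun b hb _ hbq => absurd (y.1.trans hb (y.1.symm H.rel_q)) hbq
  | @head x x' h hx' ih =>
    obtain ⟨u, v, hg, hm⟩ := h
    have hle : x.1 ≤ x'.1 := hm ▸ x.1.le_mergeClasses u v
    intro b hb hkb hbq c b' hc hb'
    by_cases h' : x'.1 b q
    · rw [hm] at h'
      rcases h' with h' | ⟨h1 | h1, h2 | h2⟩
      · exact absurd h' hbq
      · exact absurd (x.1.trans h1 (x.1.symm h2)) hbq
      · exact absurd (hg.lt b q h1 h2 hkb H.k_le b q h1 h2) (H.q_le b hb hkb).not_gt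
      · exact hg.lt q b h2 h1 H.k_le hkb c b' (x.1.trans hc h2) (x.1.trans hb' h1)
      · exact absurd (x.1.trans h1 (x.1.symm h2)) hbq
    · exact ih b hb hkb h' c b' (hle hc) (hle hb')

theorem lt_k_of_rel_p (H : IsPivot k y e p q) (hx : GoodLE k x y) (hpq : ¬ x.1 p q) {a : Fin m}
    (ha : x.1 a p) : (a : ℕ) < k := by
  by_contra hk
  exact absurd (H.lt_of_not_rel_q hx a (y.1.trans (hx.le ha) H.rel_p) (not_lt.1 hk)
    (fun h => hpq (x.1.trans (x.1.symm ha) h)) q p (x.1.refl q) (x.1.symm ha)) H.p_lt_q.not_gt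

/-- Below `y`, the number `k` is joined to the least element of its class in `y` only after `q` is:
otherwise the label `k` would occur. -/
theorem rel_pq_of_rel_e (H : IsPivot k y e p q) (hx : GoodLE k x y) : x.1 p e → x.1 p q := by
  induction hx using Relation.ReflTransGen.head_induction_on with
  | refl => exact fun _ => H.rel_pq
  | @head x x' h hx' ih =>
    have hxy : GoodLE k x y := hx'.head h
    obtain ⟨u, v, hg, hm⟩ := h
    have hle : x.1 ≤ x'.1 := hm ▸ x.1.le_mergeClasses u v
    intro hpe
    by_contra hpq
    have h' := ih (hle hpe)
    rw [hm] at h'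
    rcases h' with h' | ⟨h1 | h1, h2 | h2⟩
    · exact hpq h'
    · exact hpq (x.1.trans h1 (x.1.symm h2))
    · obtain ⟨a, ha, hka⟩ := hg.exists_le e (x.1.trans (x.1.symm hpe) h1) H.he fun b hb => by
        by_contra hbk
        have hbq : x.1 b q := x.1.trans hb (x.1.symm h2)
        have hbp : p ≠ b := by rintro rfl; exact hpq hbq
        have hbe : b ≠ e := by rintro rfl; exact hpq (x.1.trans hpe hbq)
        have h3 : p < b := lt_of_le_of_ne (H.p_le b (y.1.trans (hxy.le hbq) H.rel_q)) hbp
        have h4 : b < e := by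
          have := H.he
          exact lt_of_le_of_ne (Fin.le_def.2 (by omega)) hbe
        exact hpq (x.1.trans (x.2 p b e q h3 h4 H.e_lt_q hpe hbq) hbq)
      exact (H.lt_k_of_rel_p hxy hpq (x.1.trans ha (x.1.symm h1))).not_ge hka
    · obtain ⟨w, hw, hwv⟩ := hg.low
      exact absurd (hwv p h1) (H.p_le w (y.1.trans (hxy.le (x.1.trans hw (x.1.symm h2)))
        H.rel_q)).not_gt
    · exact hpq (x.1.trans h1 (x.1.symm h2))

theorem not_rel_pe (H : IsPivot k y e p q) (hx : GoodLE k x y) (hpq : ¬ x.1 p q) : ¬ x.1 p e :=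
  fun h => hpq (H.rel_pq_of_rel_e hx h)

/-- The classes of `p` and `q` lie to the left of every other class that contains a number above
`k` and is contained in the class of `k` in `y`. -/
theorem lt_of_rel (H : IsPivot k y e p q) (hx : GoodLE k x y) (hpq : ¬ x.1 p q) {b : Fin m}
    (hb : y.1 b e) (hkb : k ≤ (b : ℕ)) (hbq : ¬ x.1 b q) {a b' : Fin m}
    (ha : x.1 a p ∨ x.1 a q) (hb' : x.1 b' b) : a < b' := by
  rcases ha with ha | ha
  · have h1 := H.lt_k_of_rel_p hx hpq ha
    have h2 := H.lt_of_not_rel_q hx b hb hkb hbq q b' (x.1.refl q) hb'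
    have := H.k_le
    rw [Fin.lt_def] at *
    omega
  · exact H.lt_of_not_rel_q hx b hb hkb hbq a b' ha hb'

theorem isNoncrossing_mergeClasses (H : IsPivot k y e p q) (hx : GoodLE k x y) :
    IsNoncrossing (x.1.mergeClasses p q) := by
  by_cases hpq : x.1 p q
  · rw [Setoid.mergeClasses_eq_self hpq]; exact x.2
  have hB : ∀ {a}, x.1 a p ∨ x.1 a q → y.1 a e := fun h =>
    h.elim (fun h => y.1.trans (hx.le h) H.rel_p) fun h => y.1.trans (hx.le h) H.rel_q
  intro a b c d hab hbc hcd hac hbd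
  rcases hac with hac | ⟨ha, hc⟩ <;> rcases hbd with hbd | ⟨hb, hd⟩
  · exact Or.inl (x.2 a b c d hab hbc hcd hac hbd)
  · by_cases ha : x.1 a p ∨ x.1 a q
    · exact Or.inr ⟨ha, hb⟩
    exfalso
    push Not at ha
    have hye : y.1 a e := y.1.trans (y.2 a b c d hab hbc hcd (hx.le hac)
      (y.1.trans (hB hb) (y.1.symm (hB hd)))) (hB hb)
    rcases le_or_gt k (c : ℕ) with hkc | hkc
    · exact absurd (H.lt_of_rel hx hpq (y.1.trans (y.1.symm (hx.le hac)) hye) hkc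
        (fun h => ha.2 (x.1.trans hac h)) hb hac) hab.not_gt
    · have hcq : c < q := Fin.lt_def.2 (hkc.trans_le H.k_le)
      have hpa : p < a := lt_of_le_of_ne (H.p_le a hye) (by rintro rfl; exact ha.1 (x.1.refl _))
      rcases hb with hb | hb
      · exact ha.1 (x.1.symm (x.2 p a b c hpa hab hbc (x.1.symm hb) hac))
      · exact ha.2 (x.1.trans (x.2 a b c q hab hbc hcq hac hb) hb)
  · by_cases hb : x.1 b p ∨ x.1 b q
    · exact Or.inr ⟨ha, hb⟩
    exfalso
    push Not at hb
    have hye : y.1 b e := y.1.trans (y.1.symm (y.2 a b c d hab hbc hcd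
      (y.1.trans (hB ha) (y.1.symm (hB hc))) (hx.le hbd))) (hB ha)
    rcases le_or_gt k (d : ℕ) with hkd | hkd
    · exact absurd (H.lt_of_rel hx hpq (y.1.trans (y.1.symm (hx.le hbd)) hye) hkd
        (fun h => hb.2 (x.1.trans hbd h)) hc hbd) hbc.not_gt
    · have hdq : d < q := Fin.lt_def.2 (hkd.trans_le H.k_le)
      have hpb : p < b := (H.p_le a (hB ha)).trans_lt hab
      rcases hc with hc | hc
      · exact hb.1 (x.1.symm (x.2 p b c d hpb hbc hcd (x.1.symm hc) hbd))
      · exact hb.2 (x.1.trans (x.2 b c d q hbc hcd hdq hbd hc) hc)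
  · exact Or.inr ⟨ha, hb⟩

/-- The closure of a partition `x` below `y`, obtained by uniting the classes of `p` and `q`. -/
def closure (H : IsPivot k y e p q) (hx : GoodLE k x y) : NC m :=
  ⟨x.1.mergeClasses p q, H.isNoncrossing_mergeClasses hx⟩

theorem goodLE_closure (H : IsPivot k y e p q) (hx : GoodLE k x y) :
    GoodLE k x (H.closure hx) := by
  by_cases hpq : x.1 p q
  · have : H.closure hx = x := Subtype.ext (Setoid.mergeClasses_eq_self hpq)
    rw [this]
  refine Relation.ReflTransGen.single ⟨p, q, ⟨hpq, ⟨p, x.1.refl p, fun b hb => ?_⟩, ?_, ?_⟩, rfl⟩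
  · exact lt_of_le_of_ne (H.p_le b (y.1.trans (hx.le hb) H.rel_q)) (by rintro rfl; exact hpq hb)
  · intro f hf hfk _
    have hfe : f = e := Fin.ext (by have := H.he; omega)
    exact absurd (x.1.symm (hfe ▸ hf)) (H.not_rel_pe hx hpq)
  · intro a b ha _ hka
    exact absurd hka (H.lt_k_of_rel_p hx hpq ha).not_ge

/-- Uniting the classes of `p` and `q` turns a good step into a good step or an equality. -/
theorem closure_step (H : IsPivot k y e p q) (hx : GoodLE k x y) (hx' : GoodLE k x' y)
    (h : GoodStep k x x') : GoodLE k (H.closure hx) (H.closure hx') := by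
  by_cases hpq' : x'.1 p q
  · have hcx' : H.closure hx' = x' := Subtype.ext (Setoid.mergeClasses_eq_self hpq')
    by_cases hpq : x.1 p q
    · have hcx : H.closure hx = x := Subtype.ext (Setoid.mergeClasses_eq_self hpq)
      rw [hcx, hcx']
      exact Relation.ReflTransGen.single h
    · obtain ⟨u, v, hg, hm⟩ := h
      -- The step unites the classes of `p` and `q`.
      have heq : H.closure hx = H.closure hx' := by
        rw [hcx']
        refine Subtype.ext (le_antisymm (Setoid.mergeClasses_le_iff.2 ⟨?_, hpq'⟩) ?_)
        · exact hm ▸ x.1.le_mergeClasses u v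
        · rw [hm] at hpq' ⊢
          refine Setoid.mergeClasses_le_iff.2 ⟨x.1.le_mergeClasses p q, ?_⟩
          rcases hpq' with h' | ⟨h1 | h1, h2 | h2⟩
          · exact absurd h' hpq
          · exact absurd (x.1.trans h1 (x.1.symm h2)) hpq
          · exact Or.inr ⟨Or.inl (x.1.symm h1), Or.inr (x.1.symm h2)⟩
          · exact Or.inr ⟨Or.inr (x.1.symm h2), Or.inl (x.1.symm h1)⟩
          · exact absurd (x.1.trans h1 (x.1.symm h2)) hpq
      rw [heq]
  have hle : x.1 ≤ x'.1 := h.le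
  have hpq : ¬ x.1 p q := fun h' => hpq' (hle h')
  obtain ⟨u, v, hg, hm⟩ := h
  have huv : x'.1 u v := hm ▸ x.1.mergeClasses_pair u v
  set M := x.1.mergeClasses p q with hM
  -- A third class united with that of `p` or `q` is united with their union from above.
  have key : ∀ z z', (z' = p ∨ z' = q) → ¬ (x.1 z p ∨ x.1 z q) → x'.1 z z' →
      x'.1 = x.1.mergeClasses z' z → GoodStep k (H.closure hx) (H.closure hx') := by
    intro z z' hz' hz hzz' hm'
    have hyz : y.1 z e := y.1.trans (hx'.le hzz')
      (hz'.elim (fun h => h ▸ H.rel_p) fun h => h ▸ H.rel_q)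
    push Not at hz
    have hMz : ∀ b, M b z → x.1 b z := by
      rintro b (hb | ⟨-, hb | hb⟩)
      exacts [hb, absurd hb hz.1, absurd hb hz.2]
    have hMp : ∀ a, M a p → x.1 a p ∨ x.1 a q := by
      rintro a (ha | ⟨ha, -⟩)
      exacts [Or.inl ha, ha]
    have hyb : ∀ b, x.1 b z → y.1 b e := fun b hb => y.1.trans (hx.le hb) hyz
    refine ⟨p, z, ⟨fun h => hz.1 (x.1.symm (hMz p h)), ⟨p, M.refl p, fun b hb => ?_⟩, ?_, ?_⟩, ?_⟩
    · exact lt_of_le_of_ne (H.p_le b (hyb b (hMz b hb)))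
        (by rintro rfl; exact hz.1 (x.1.symm (hMz _ hb)))
    · exact fun _ _ _ _ => ⟨q, M.symm (x.1.mergeClasses_pair p q), H.k_le⟩
    · intro a b _ hb _ hkb a' b' ha' hb'
      have hb := hMz b hb
      exact H.lt_of_rel hx hpq (hyb b hb) hkb (fun h => hz.2 (x.1.trans (x.1.symm hb) h))
        (hMp a' ha') (x.1.trans (hMz b' hb') (x.1.symm hb))
    · change x'.1.mergeClasses p q = M.mergeClasses p z
      refine eq_of_forall_ge_iff fun t => ?_
      rw [hm', hM]
      simp only [Setoid.mergeClasses_le_iff]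
      rcases hz' with rfl | rfl
      · tauto
      · exact ⟨fun h => ⟨⟨h.1.1, h.2⟩, t.trans h.2 h.1.2⟩,
          fun h => ⟨⟨h.1.1, t.trans (t.symm h.1.2) h.2⟩, h.1.2⟩⟩
  have hsame : ∀ {z w : Fin m}, x.1 z w → x.1.mergeClasses z = x.1.mergeClasses w := by
    intro z w h
    funext c
    exact Setoid.ext fun a b => by
      simp only [Setoid.mergeClasses_apply]
      rw [show x.1 a z ↔ x.1 a w from ⟨(x.1.trans · h), (x.1.trans · (x.1.symm h))⟩,
        show x.1 b z ↔ x.1 b w from ⟨(x.1.trans · h), (x.1.trans · (x.1.symm h))⟩]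
  refine Relation.ReflTransGen.single ?_
  by_cases hu : x.1 u p ∨ x.1 u q
  · have hv : ¬ (x.1 v p ∨ x.1 v q) := by
      intro hv
      rcases hu with hu | hu <;> rcases hv with hv | hv
      · exact hg.not_rel (x.1.trans hu (x.1.symm hv))
      · exact hpq' (x'.1.trans (x'.1.symm (hle hu)) (x'.1.trans huv (hle hv)))
      · exact hpq' (x'.1.trans (x'.1.symm (hle hv)) (x'.1.trans (x'.1.symm huv) (hle hu)))
      · exact hg.not_rel (x.1.trans hu (x.1.symm hv))
    rcases hu with hu | hu
    · exact key v p (Or.inl rfl) hv (x'.1.trans (x'.1.symm huv) (hle hu)) (by rw [hm, hsame hu])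
    · exact key v q (Or.inr rfl) hv (x'.1.trans (x'.1.symm huv) (hle hu)) (by rw [hm, hsame hu])
  by_cases hv : x.1 v p ∨ x.1 v q
  · rcases hv with hv | hv
    · exact key u p (Or.inl rfl) hu (x'.1.trans huv (hle hv))
        (by rw [hm, x.1.mergeClasses_comm u, hsame hv])
    · exact key u q (Or.inr rfl) hu (x'.1.trans huv (hle hv))
        (by rw [hm, x.1.mergeClasses_comm u, hsame hv])
  have hMu : ∀ b, M b u ↔ x.1 b u :=
    fun b => ⟨fun h => h.resolve_right fun h => hu h.2, Or.inl⟩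
  have hMv : ∀ b, M b v ↔ x.1 b v :=
    fun b => ⟨fun h => h.resolve_right fun h => hv h.2, Or.inl⟩
  refine ⟨u, v, ⟨?_, ?_, ?_, ?_⟩, ?_⟩
  · exact fun h => hg.not_rel ((hMv u).1 h)
  · change ∃ w, M w u ∧ ∀ b, M b v → w < b
    simpa only [hMu, hMv] using hg.low
  · change ∀ e, M e u → (e : ℕ) + 1 = k → (∀ b, M b v → k ≤ (b : ℕ)) → ∃ a, M a u ∧ k ≤ (a : ℕ)
    simpa only [hMu, hMv] using hg.exists_le
  · change ∀ a b, M a u → M b v → k ≤ (a : ℕ) → k ≤ (b : ℕ) → ∀ a' b', M a' u → M b' v → a' < b'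
    simpa only [hMu, hMv] using hg.lt
  · change x'.1.mergeClasses p q = M.mergeClasses u v
    refine eq_of_forall_ge_iff fun t => ?_
    rw [hm, hM]
    simp only [Setoid.mergeClasses_le_iff]
    tauto

theorem closure_mono (H : IsPivot k y e p q) (hx : GoodLE k x y) (hx' : GoodLE k x' y)
    (h : GoodLE k x x') : GoodLE k (H.closure hx) (H.closure hx') := by
  induction h using Relation.ReflTransGen.head_induction_on with
  | refl => exact Relation.ReflTransGen.refl
  | @head x x₁ h h' ih =>
    exact (H.closure_step hx (h'.trans hx') h).trans (ih (h'.trans hx'))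

theorem closure_eq_self (H : IsPivot k y e p q) (hx : GoodLE k x y) (h : x.1 p q) :
    H.closure hx = x := Subtype.ext (Setoid.mergeClasses_eq_self h)

/-- If the closure of `x ≠ y` is `y`, then `x` still joins `k` to a number above `k`. -/
theorem rel_qe_of_closure_eq (H : IsPivot k y e p q) (hx : GoodLE k x y) (hxy : x ≠ y)
    (h : H.closure hx = y) : x.1 q e := by
  have hpq : ¬ x.1 p q := fun hpq => hxy ((H.closure_eq_self hx hpq).symm.trans h)
  have h' : x.1.mergeClasses p q p e := by
    rw [show x.1.mergeClasses p q = y.1 from congrArg Subtype.val h]; exact H.rel_p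
  rcases h' with h' | ⟨-, h' | h'⟩
  · exact absurd h' (H.not_rel_pe hx hpq)
  · exact absurd (x.1.symm h') (H.not_rel_pe hx hpq)
  · exact x.1.symm h'

end IsPivot

end Good

/-! ### Möbius functions and closure operators -/

/-- Rota's closure theorem, with a recursive hypothesis: if a closure operator `f` on the interval
below `y` moves the minimum and every `x ≠ y` with closure `y` satisfies `μ(b, x) = 0`, then
`μ(b, y) = 0`. -/
theorem mu_eq_zero_of_closure {α : Type*} [PartialOrder α] [Finite α] [LocallyFiniteOrder α]
    [DecidableEq α] {b y : α} (hb : IsBot b) (f : α → α) (hle : ∀ x ≤ y, x ≤ f x)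
    (hmono : ∀ x x', x ≤ x' → x' ≤ y → f x ≤ f x') (hidem : ∀ x ≤ y, f (f x) = f x)
    (hfy : f y = y) (hfb : f b ≠ b)
    (h0 : ∀ x ≤ y, x ≠ y → f x = y → IncidenceAlgebra.mu ℤ b x = 0) :
    IncidenceAlgebra.mu ℤ b y = 0 := by
  -- The sum of `μ(b, x)` over each fibre of the closure operator vanishes.
  have key : ∀ z, z ≤ y → f z = z →
      ∑ x ∈ (Finset.Icc b z).filter (fun x => f x = z), IncidenceAlgebra.mu ℤ b x = 0 := by
    intro z
    induction z using WellFoundedLT.induction with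
    | ind z ih =>
      intro hzy hfz
      have hbz : b ≠ z := by rintro rfl; exact hfb hfz
      have hsum := IncidenceAlgebra.sum_Icc_mu_right (𝕜 := ℤ) b z
      rw [if_neg hbz, ← Finset.sum_fiberwise_of_maps_to (g := f) (t := Finset.Icc b z)
        (fun x hx => Finset.mem_Icc.2 ⟨hb _, (hmono x z (Finset.mem_Icc.1 hx).2 hzy).trans_eq hfz⟩),
        Finset.sum_eq_single z] at hsum
      · exact hsum
      · intro w hw hwz
        have hwz' : w < z := lt_of_le_of_ne (Finset.mem_Icc.1 hw).2 hwz
        by_cases hfw : f w = w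
        · rw [← ih w hwz' (hwz'.le.trans hzy) hfw]
          refine Finset.sum_congr (Finset.ext fun x => ?_) fun _ _ => rfl
          simp only [Finset.mem_filter, Finset.mem_Icc]
          refine ⟨fun h => ⟨⟨h.1.1, ?_⟩, h.2⟩, fun h => ⟨⟨h.1.1, h.1.2.trans hwz'.le⟩, h.2⟩⟩
          exact (hle x (h.1.2.trans hzy)).trans_eq h.2
        · refine Finset.sum_eq_zero fun x hx => ?_
          obtain ⟨hxz, rfl⟩ := Finset.mem_filter.1 hx
          exact absurd (hidem x ((Finset.mem_Icc.1 hxz).2.trans hzy)) hfw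
      · exact fun h => absurd (Finset.mem_Icc.2 ⟨hb z, le_rfl⟩) h
  have h := key y le_rfl hfy
  rwa [Finset.sum_eq_single y] at h
  · intro x hx hxy
    obtain ⟨hx, hfx⟩ := Finset.mem_filter.1 hx
    exact h0 x (Finset.mem_Icc.1 hx).2 hxy hfx
  · exact fun h => (h (Finset.mem_filter.2 ⟨Finset.mem_Icc.2 ⟨hb y, le_rfl⟩, hfy⟩)).elim

/-! ### Edge labels and counting classes -/

section Labels

variable {m k : ℕ}

/-- The label of the step that unites the classes of `u` and `v`, the former containing the least
element of the union. -/
def IsMergeLabel (s : Setoid (Fin m)) (u v : Fin m) (l : ℕ) : Prop :=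
  ∃ x, IsGreatest {z | s z u ∧ ∀ b, s b v → z < b} x ∧ l = (x : ℕ) + 1

theorem IsMergeLabel.not_rel {s : Setoid (Fin m)} {u v : Fin m} {l : ℕ}
    (h : IsMergeLabel s u v l) : ¬ s u v := by
  obtain ⟨x, hx, -⟩ := h
  exact fun huv => (hx.1.2 x (s.trans hx.1.1 huv)).false

theorem IsEdgeLabel.exists_mergeClasses {x y : NC m} {l : ℕ} (hxy : x ⋖ y)
    (h : IsEdgeLabel x y l) : ∃ u v, IsMergeLabel x.1 u v l ∧ y.1 = x.1.mergeClasses u v := by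
  obtain ⟨_, ⟨u, rfl⟩, _, ⟨v, rfl⟩, -, hB, -, hl⟩ := h
  have hl' : IsMergeLabel x.1 u v l := hl
  refine ⟨u, v, hl', ?_⟩
  have hmem : ∀ {a b}, (x.1 a u ∨ x.1 a v) → (y.1 a b ↔ (x.1 b u ∨ x.1 b v)) := by
    intro a b ha
    obtain ⟨w, hw⟩ := hB
    have hw' : ∀ z, (x.1 z u ∨ x.1 z v) ↔ y.1 z w := fun z => Set.ext_iff.1 hw z
    rw [hw' b]
    exact ⟨fun h => y.1.trans (y.1.symm h) ((hw' a).1 ha),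
      fun h => y.1.trans ((hw' a).1 ha) (y.1.symm h)⟩
  have hle : x.1.mergeClasses u v ≤ y.1 :=
    Setoid.mergeClasses_le_iff.2 ⟨hxy.le, (hmem (Or.inl (x.1.refl u))).2 (Or.inr (x.1.refl v))⟩
  have hnc : IsNoncrossing (x.1.mergeClasses u v) := by
    intro a b c d hab hbc hcd hac hbd
    have hy := y.2 a b c d hab hbc hcd (hle hac) (hle hbd)
    by_cases ha : x.1 a u ∨ x.1 a v
    · exact Or.inr ⟨ha, (hmem ha).1 hy⟩
    by_cases hb : x.1 b u ∨ x.1 b v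
    · exact Or.inr ⟨(hmem hb).1 (y.1.symm hy), hb⟩
    exact Or.inl (x.2 a b c d hab hbc hcd (hac.resolve_right fun h => ha h.1)
      (hbd.resolve_right fun h => hb h.1))
  by_contra hne
  refine hxy.2 (c := ⟨_, hnc⟩) (lt_of_le_of_ne (x.1.le_mergeClasses u v) fun h => ?_)
    (lt_of_le_of_ne hle fun h => hne (congrArg Subtype.val h).symm)
  refine hl'.not_rel ?_
  rw [show x.1 = x.1.mergeClasses u v from congrArg Subtype.val h]
  exact x.1.mergeClasses_pair u v

theorem covBy_of_eq_mergeClasses {x y : NC m} {u v : Fin m} (huv : ¬ x.1 u v)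
    (h : y.1 = x.1.mergeClasses u v) : x ⋖ y := by
  have hle : x ≤ y := show x.1 ≤ y.1 from h ▸ x.1.le_mergeClasses u v
  refine ⟨lt_of_le_of_ne hle fun hxy => huv ?_, fun z hxz hzy => hzy.not_ge ?_⟩
  · rw [hxy, h]; exact x.1.mergeClasses_pair u v
  · have hzle : x.1 ≤ z.1 := hxz.le
    change y.1 ≤ z.1
    rw [h]
    refine Setoid.mergeClasses_le_iff.2 ⟨hzle, ?_⟩
    by_contra hz
    refine hxz.not_ge (show z.1 ≤ x.1 from fun a b hab => ?_)
    have hy : y.1 a b := (show z.1 ≤ y.1 from hzy.le) hab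
    rw [h] at hy
    rcases hy with hy | ⟨h1 | h1, h2 | h2⟩
    · exact hy
    · exact x.1.trans h1 (x.1.symm h2)
    · exact absurd (z.1.trans (z.1.symm (hzle h1)) (z.1.trans hab (hzle h2))) hz
    · exact absurd (z.1.trans (z.1.symm (hzle h2)) (z.1.trans (z.1.symm hab) (hzle h1))) hz
    · exact x.1.trans h1 (x.1.symm h2)

theorem IsMergeLabel.isEdgeLabel {x y : NC m} {u v : Fin m} {l : ℕ} (h : IsMergeLabel x.1 u v l)
    (hy : y.1 = x.1.mergeClasses u v) : IsEdgeLabel x y l := by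
  refine ⟨_, ⟨u, rfl⟩, _, ⟨v, rfl⟩, fun heq => h.not_rel ?_, ⟨u, ?_⟩, ?_, h⟩
  · exact (Set.ext_iff.1 heq u).1 (x.1.refl u)
  · ext a
    change (x.1 a u ∨ x.1 a v) ↔ y.1 a u
    rw [hy]
    exact ⟨fun ha => Or.inr ⟨ha, Or.inl (x.1.refl u)⟩, fun ha => ha.elim Or.inl And.left⟩
  · obtain ⟨z, hz, -⟩ := h
    obtain ⟨w, hw, hw'⟩ := exists_minimal_of_wellFoundedLT (fun a => x.1 a u) ⟨u, x.1.refl u⟩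
    have hmin : ∀ a, x.1 a u → w ≤ a := fun a ha => (le_total w a).elim id fun h => hw' ha h
    refine ⟨w, hw, Or.inl hw, ?_⟩
    rintro a (ha | ha)
    · exact hmin a ha
    · exact (hmin z hz.1.1).trans (hz.1.2 a ha).le

theorem exists_isMergeLabel {s : Setoid (Fin m)} {u v : Fin m}
    (h : ∃ w, s w u ∧ ∀ b, s b v → w < b) : ∃ l, IsMergeLabel s u v l := by
  obtain ⟨x, hx, hx'⟩ := exists_maximal_of_wellFoundedGT
    (fun z => s z u ∧ ∀ b, s b v → z < b) h
  exact ⟨_, x, ⟨hx, fun a ha => (le_total a x).elim id fun h => hx' ha h⟩, rfl⟩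

/-- Two elements with values at least `j` are related by `y` but not by `x`. -/
def Joins (j : ℕ) (x y : NC m) : Prop :=
  ∃ a b : Fin m, j ≤ (a : ℕ) ∧ j ≤ (b : ℕ) ∧ ¬ x.1 a b ∧ y.1 a b

theorem joins_iff {j : ℕ} {x y : NC m} {u v : Fin m} (huv : ¬ x.1 u v)
    (h : y.1 = x.1.mergeClasses u v) :
    Joins j x y ↔ ∃ a b : Fin m, x.1 a u ∧ x.1 b v ∧ j ≤ (a : ℕ) ∧ j ≤ (b : ℕ) := by
  constructor
  · rintro ⟨a, b, ha, hb, hab, hy⟩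
    rw [h] at hy
    rcases hy with hy | ⟨h1 | h1, h2 | h2⟩
    · exact absurd hy hab
    · exact absurd (x.1.trans h1 (x.1.symm h2)) hab
    · exact ⟨a, b, h1, h2, ha, hb⟩
    · exact ⟨b, a, h2, h1, hb, ha⟩
    · exact absurd (x.1.trans h1 (x.1.symm h2)) hab
  · rintro ⟨a, b, ha, hb, hja, hjb⟩
    refine ⟨a, b, hja, hjb, fun hab => huv (x.1.trans (x.1.symm ha) (x.1.trans hab hb)), ?_⟩
    rw [h]
    exact Or.inr ⟨Or.inl ha, Or.inr hb⟩

/-- A label `l` comes from an element of the lower class that has the whole upper class to its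
right, so both classes contain numbers that are at least `l`. -/
theorem IsMergeLabel.joins {j l : ℕ} {x y : NC m} {u v : Fin m} (hl : IsMergeLabel x.1 u v l)
    (h : y.1 = x.1.mergeClasses u v) (hj : j + 1 ≤ l) : Joins j x y := by
  refine (joins_iff hl.not_rel h).2 ?_
  obtain ⟨z, hz, rfl⟩ := hl
  have := Fin.lt_def.1 (hz.1.2 v (x.1.refl v))
  exact ⟨z, v, hz.1.1, x.1.refl v, by omega, by omega⟩

open Classical in
/-- The least elements of the classes of `x` restricted to the elements with value at least `j`. -/
noncomputable def blockMins (j : ℕ) (x : NC m) : Finset (Fin m) :=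
  Finset.univ.filter fun b => j ≤ (b : ℕ) ∧ ∀ a : Fin m, j ≤ (a : ℕ) → x.1 a b → b ≤ a

theorem mem_blockMins {j : ℕ} {x : NC m} {b : Fin m} :
    b ∈ blockMins j x ↔ j ≤ (b : ℕ) ∧ ∀ a : Fin m, j ≤ (a : ℕ) → x.1 a b → b ≤ a := by
  simp [blockMins]

theorem exists_blockMin {j : ℕ} {x : NC m} {a u : Fin m} (ha : x.1 a u) (hj : j ≤ (a : ℕ)) :
    ∃ p, x.1 p u ∧ p ∈ blockMins j x ∧ ∀ a : Fin m, j ≤ (a : ℕ) → x.1 a u → p ≤ a := by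
  obtain ⟨p, hp, hp'⟩ := exists_minimal_of_wellFoundedLT
    (fun a : Fin m => x.1 a u ∧ j ≤ (a : ℕ)) ⟨a, ha, hj⟩
  have hmin : ∀ a : Fin m, j ≤ (a : ℕ) → x.1 a u → p ≤ a :=
    fun a ha h => (le_total p a).elim id fun h' => hp' ⟨h, ha⟩ h'
  exact ⟨p, hp.1, mem_blockMins.2 ⟨hp.2, fun a ha h => hmin a ha (x.1.trans h hp.1)⟩, hmin⟩

open Classical in
/-- A step lowers the number of classes restricted to the elements with value at least `j` by one
if both united classes contain such elements, and by zero otherwise. -/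
theorem card_blockMins_step {j : ℕ} {x y : NC m} {u v : Fin m} (huv : ¬ x.1 u v)
    (h : y.1 = x.1.mergeClasses u v) :
    (blockMins j x).card = (blockMins j y).card + if Joins j x y then 1 else 0 := by
  have hle : x.1 ≤ y.1 := h ▸ x.1.le_mergeClasses u v
  have hsub : blockMins j y ⊆ blockMins j x := fun b hb =>
    mem_blockMins.2 ⟨(mem_blockMins.1 hb).1, fun a ha hab => (mem_blockMins.1 hb).2 a ha (hle hab)⟩
  split_ifs with hJ
  · -- The larger of the minima of the two united classes is no longer a minimum.
    have main : ∀ {u v : Fin m}, y.1 = x.1.mergeClasses u v → ∀ {p q : Fin m}, x.1 p u →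
        p ∈ blockMins j x → (∀ a : Fin m, j ≤ (a : ℕ) → x.1 a u → p ≤ a) → x.1 q v →
        q ∈ blockMins j x → (∀ a : Fin m, j ≤ (a : ℕ) → x.1 a v → q ≤ a) → p < q →
        (blockMins j x).card = (blockMins j y).card + 1 := by
      intro u v h p q hp hpm hpu hq hqm hqv hpq
      have : blockMins j y = (blockMins j x).erase q := by
        ext b
        rw [Finset.mem_erase]
        refine ⟨fun hb => ⟨?_, hsub hb⟩, fun ⟨hbq, hb⟩ => ?_⟩
        · rintro rfl
          refine ((mem_blockMins.1 hb).2 p (mem_blockMins.1 hpm).1 ?_).not_gt hpq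
          rw [h]
          exact Or.inr ⟨Or.inl hp, Or.inr hq⟩
        · obtain ⟨hjb, hb⟩ := mem_blockMins.1 hb
          refine mem_blockMins.2 ⟨hjb, fun a ha hab => ?_⟩
          rw [h] at hab
          rcases hab with hab | ⟨ha', hb' | hb'⟩
          · exact hb a ha hab
          · have hbp := hb p (mem_blockMins.1 hpm).1 (x.1.trans hp (x.1.symm hb'))
            rcases ha' with ha' | ha'
            · exact hbp.trans (hpu a ha ha')
            · exact hbp.trans (hpq.le.trans (hqv a ha ha'))
          · exact absurd (le_antisymm (hb q (mem_blockMins.1 hqm).1 (x.1.trans hq (x.1.symm hb')))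
              (hqv b hjb hb')) hbq
      rw [this, Finset.card_erase_add_one hqm]
    obtain ⟨a, b, ha, hb, hja, hjb⟩ := (joins_iff huv h).1 hJ
    obtain ⟨p, hp, hpm, hpu⟩ := exists_blockMin ha hja
    obtain ⟨q, hq, hqm, hqv⟩ := exists_blockMin hb hjb
    rcases lt_trichotomy p q with hpq | rfl | hpq
    · exact main h hp hpm hpu hq hqm hqv hpq
    · exact absurd (x.1.trans (x.1.symm hp) hq) huv
    · exact main (h.trans (x.1.mergeClasses_comm u v)) hq hqm hqv hp hpm hpu hpq
  · rw [add_zero]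
    congr 1
    refine Finset.Subset.antisymm (fun b hb => ?_) hsub
    obtain ⟨hjb, hb⟩ := mem_blockMins.1 hb
    refine mem_blockMins.2 ⟨hjb, fun a ha hab => hb a ha ?_⟩
    by_contra hx
    exact hJ ⟨a, b, ha, hjb, hx, hab⟩

theorem card_blockMins_bot {n j : ℕ} (hj : j ≤ n) :
    (blockMins j (⊥ : NC (n + 1))).card = n + 1 - j := by
  have : blockMins j (⊥ : NC (n + 1)) = Finset.Ici (⟨j, by omega⟩ : Fin (n + 1)) := by
    ext b
    rw [mem_blockMins, Finset.mem_Ici, Fin.le_def]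
    exact ⟨And.left, fun h => ⟨h, fun a _ (hab : a = b) => hab.ge⟩⟩
  rw [this, Fin.card_Ici]

theorem card_blockMins_top {n j : ℕ} (hj : j ≤ n) :
    (blockMins j (⊤ : NC (n + 1))).card = 1 := by
  have : blockMins j (⊤ : NC (n + 1)) = {(⟨j, by omega⟩ : Fin (n + 1))} := by
    ext b
    rw [mem_blockMins, Finset.mem_singleton]
    constructor
    · exact fun h => le_antisymm (h.2 _ le_rfl trivial) (Fin.le_def.2 h.1)
    · rintro rfl
      exact ⟨le_rfl, fun a ha _ => Fin.le_def.2 ha⟩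
  rw [this, Finset.card_singleton]

open Classical in
/-- Every maximal chain has exactly `n - j` steps uniting classes with elements of value at
least `j`. -/
theorem card_joins {n j : ℕ} (hj : j ≤ n) {c : Fin (n + 1) → NC (n + 1)} (h0 : c 0 = ⊥)
    (h1 : c (Fin.last n) = ⊤)
    (h : ∀ i : Fin n, ∃ u v, ¬ (c i.castSucc).1 u v ∧
      (c i.succ).1 = (c i.castSucc).1.mergeClasses u v) :
    (Finset.univ.filter fun i : Fin n => Joins j (c i.castSucc) (c i.succ)).card = n - j := by
  have telescope : ∀ (N : ℕ) (f : Fin (N + 1) → ℕ) (g : Fin N → ℕ),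
      (∀ i : Fin N, f i.castSucc = f i.succ + g i) → f 0 = f (Fin.last N) + ∑ i, g i := by
    intro N
    induction N with
    | zero => intro f g _; simp
    | succ N ih =>
      intro f g hfg
      rw [Fin.sum_univ_castSucc]
      have h1 := ih (fun i => f i.castSucc) (fun i => g i.castSucc) (fun i => hfg i.castSucc)
      have h2 : f (Fin.last N).castSucc = f (Fin.last (N + 1)) + g (Fin.last N) := hfg _
      rw [Fin.castSucc_zero] at h1
      omega
  have key := telescope n (fun i => (blockMins j (c i)).card)
    (fun i => if Joins j (c i.castSucc) (c i.succ) then 1 else 0) fun i => by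
      obtain ⟨u, v, huv, hm⟩ := h i
      exact card_blockMins_step huv hm
  simp only [h0, h1, card_blockMins_bot hj, card_blockMins_top hj, ← Finset.card_filter] at key
  omega

/-! ### The chains of `PF n k` are the maximal chains of good steps -/

/-- In a chain labelled by an element of `PF n k`, the labels `k + 1, …, n` are used by as many
steps as unite two classes containing numbers above `k`. -/
theorem goodStep_of_mem_chainsPF {n k : ℕ} {c : Fin (n + 1) → NC (n + 1)} (hc : c ∈ chainsPF n k)
    (i : Fin n) : GoodStep k (c i.castSucc) (c i.succ) := by
  classical
  obtain ⟨⟨h0, h1, hcov⟩, a, ⟨-, hak, hsurj⟩, hlab⟩ := hc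
  have hm := fun i => (hlab i).exists_mergeClasses (hcov i)
  have hjoins : ∀ j, k ≤ j → ∀ i : Fin n, Joins j (c i.castSucc) (c i.succ) → j + 1 ≤ a i := by
    intro j hkj
    rcases le_or_gt j n with hj | hj
    · have hcard := card_joins hj h0 h1 fun i => by
        obtain ⟨u, v, hl, hm⟩ := hm i
        exact ⟨u, v, hl.not_rel, hm⟩
      have hsub : (Finset.univ.filter fun i : Fin n => j + 1 ≤ a i) ⊆
          Finset.univ.filter fun i : Fin n => Joins j (c i.castSucc) (c i.succ) := by
        intro i hi
        obtain ⟨u, v, hl, hm⟩ := hm i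
        exact Finset.mem_filter.2 ⟨Finset.mem_univ i, hl.joins hm (Finset.mem_filter.1 hi).2⟩
      have hge : n - j ≤ (Finset.univ.filter fun i : Fin n => j + 1 ≤ a i).card := by
        calc n - j = (Finset.Icc (j + 1) n).card := by simp
          _ ≤ ((Finset.univ.filter fun i : Fin n => j + 1 ≤ a i).image a).card := by
            refine Finset.card_le_card fun l hl => ?_
            rw [Finset.mem_Icc] at hl
            obtain ⟨i, rfl⟩ := hsurj l (by omega) hl.2
            exact Finset.mem_image_of_mem a (Finset.mem_filter.2 ⟨Finset.mem_univ i, hl.1⟩)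
          _ ≤ _ := Finset.card_image_le
      have heq := Finset.eq_of_subset_of_card_le hsub (hcard.trans_le hge)
      intro i hi
      have : i ∈ Finset.univ.filter fun i : Fin n => j + 1 ≤ a i := by
        rw [heq]; exact Finset.mem_filter.2 ⟨Finset.mem_univ i, hi⟩
      exact (Finset.mem_filter.1 this).2
    · rintro i ⟨a, -, ha, -⟩
      have := a.2
      omega
  obtain ⟨u, v, hl, hy⟩ := hm i
  have hnr := hl.not_rel
  have hJ := fun j => joins_iff (j := j) hnr hy
  obtain ⟨z, hz, hzl⟩ := hl
  set x := c i.castSucc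
  refine ⟨u, v, ⟨hnr, ⟨z, hz.1.1, hz.1.2⟩, ?_, ?_⟩, hy⟩
  · intro e he hek hv
    by_contra hcon
    push Not at hcon
    refine hak i ?_
    have h1 := hz.2 (show e ∈ _ from ⟨he, fun b hb => Fin.lt_def.2 (by have := hv b hb; omega)⟩)
    have h2 := hcon z hz.1.1
    rw [Fin.le_def] at h1
    omega
  · intro a₀ b₀ ha₀ hb₀ hka hkb a' b' ha' hb'
    have hzb : ∀ b, x.1 b v → (z : ℕ) < b := fun b hb => Fin.lt_def.1 (hz.1.2 b hb)
    have hlab' : ∀ a b : Fin (n + 1), x.1 a u → x.1 b v → k ≤ (a : ℕ) → k ≤ (b : ℕ) →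
        (a : ℕ) ≤ z ∨ (b : ℕ) ≤ z := by
      intro a b ha hb hka hkb
      have := hjoins (min a b) (le_min hka hkb) i
        ((hJ _).2 ⟨a, b, ha, hb, min_le_left _ _, min_le_right _ _⟩)
      omega
    have h1 := hlab' a₀ b₀ ha₀ hb₀ hka hkb
    have h2 := hzb b₀ hb₀
    have h3 := hzb b' hb'
    rw [Fin.lt_def]
    by_contra hlt
    have h4 := hlab' a' b' ha' hb' (by omega) (by omega)
    omega

/-- A tuple of positive integers is a parking function if at most `n - j` of its entries exceed
`j`, for all `j ≤ n`. -/
theorem isParkingFunction_of_card_le {n : ℕ} {a : Fin n → ℕ} (hpos : ∀ i, 1 ≤ a i)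
    (h : ∀ j ≤ n, (Finset.univ.filter fun i => j + 1 ≤ a i).card ≤ n - j) :
    IsParkingFunction a := by
  refine ⟨hpos, Tuple.sort a, Tuple.monotone_sort a, fun i => ?_⟩
  by_contra hcon
  have hi := i.2
  have hle := h (i + 1) (by omega)
  have : ((Finset.Ici i).map (Tuple.sort a).toEmbedding).card ≤ _ :=
    (Finset.card_le_card fun l hl => by
      obtain ⟨l, hil, rfl⟩ := Finset.mem_map.1 hl
      have := Tuple.monotone_sort a (Finset.mem_Ici.1 hil)
      simp only [Function.comp_apply] at this
      refine Finset.mem_filter.2 ⟨Finset.mem_univ _, ?_⟩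
      simp only [Equiv.coe_toEmbedding]
      omega).trans hle
  rw [Finset.card_map, Fin.card_Ici] at this
  omega

theorem mem_chainsPF_of_goodStep {n k : ℕ} {c : Fin (n + 1) → NC (n + 1)} (h0 : c 0 = ⊥)
    (h1 : c (Fin.last n) = ⊤) (h : ∀ i : Fin n, GoodStep k (c i.castSucc) (c i.succ)) :
    c ∈ chainsPF n k := by
  classical
  choose u v hg hm using h
  choose a hl using fun i => exists_isMergeLabel (hg i).low
  have hcard : ∀ j ≤ n, _ := fun j hj => card_joins (j := j) hj h0 h1
    fun i => ⟨u i, v i, (hg i).not_rel, hm i⟩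
  have hsub : ∀ j, (Finset.univ.filter fun i : Fin n => j + 1 ≤ a i) ⊆
      Finset.univ.filter fun i : Fin n => Joins j (c i.castSucc) (c i.succ) := fun j i hi =>
    Finset.mem_filter.2 ⟨Finset.mem_univ i, (hl i).joins (hm i) (Finset.mem_filter.1 hi).2⟩
  have heq : ∀ j, k ≤ j → (Finset.univ.filter fun i : Fin n => j + 1 ≤ a i) =
      Finset.univ.filter fun i : Fin n => Joins j (c i.castSucc) (c i.succ) := by
    refine fun j hkj => (hsub j).antisymm fun i hi => ?_
    obtain ⟨a', b', ha', hb', hja, hjb⟩ :=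
      (joins_iff (hg i).not_rel (hm i)).1 (Finset.mem_filter.1 hi).2
    obtain ⟨z, hz, hza⟩ := hl i
    have := Fin.le_def.1 (hz.2 (show a' ∈ _ from ⟨ha', fun b hb =>
      (hg i).lt a' b' ha' hb' (by omega) (by omega) a' b ha' hb⟩))
    exact Finset.mem_filter.2 ⟨Finset.mem_univ i, by omega⟩
  refine ⟨⟨h0, h1, fun i => covBy_of_eq_mergeClasses (hg i).not_rel (hm i)⟩, a,
    ⟨isParkingFunction_of_card_le ?_ ?_, ?_, ?_⟩, fun i => (hl i).isEdgeLabel (hm i)⟩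
  · intro i
    obtain ⟨z, -, hz⟩ := hl i
    omega
  · exact fun j hj => (Finset.card_le_card (hsub j)).trans_eq (hcard j hj)
  · intro i hk
    obtain ⟨z, hz, hza⟩ := hl i
    have hv : ∀ b, (c i.castSucc).1 b (v i) → k ≤ (b : ℕ) := fun b hb => by
      have := Fin.lt_def.1 (hz.1.2 b hb)
      omega
    obtain ⟨a', ha', hka⟩ := (hg i).exists_le z hz.1.1 (by omega) hv
    have hvv := (c i.castSucc).1.refl (v i)
    have := Fin.le_def.1 (hz.2 (show a' ∈ _ from ⟨ha', fun b hb =>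
      (hg i).lt a' (v i) ha' hvv hka (hv _ hvv) a' b ha' hb⟩))
    omega
  · intro l hkl hln
    -- One more entry exceeds `l - 1` than exceeds `l`.
    have hc1 := hcard (l - 1) (by omega)
    have hc2 := hcard l hln
    rw [← heq _ (by omega)] at hc1 hc2
    by_contra hcon
    push Not at hcon
    have : (Finset.univ.filter fun i : Fin n => l - 1 + 1 ≤ a i) =
        Finset.univ.filter fun i : Fin n => l + 1 ≤ a i := by
      refine Finset.filter_congr fun i _ => ?_
      have := hcon i
      omega
    rw [this] at hc1
    omega

theorem GoodLE.exists_path {x y : NC m} (h : GoodLE k x y) : ∃ (L : ℕ) (c : ℕ → NC m),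
    c 0 = x ∧ c L = y ∧ ∀ i < L, GoodStep k (c i) (c (i + 1)) := by
  induction h using Relation.ReflTransGen.head_induction_on with
  | refl => exact ⟨0, fun _ => y, rfl, rfl, by simp⟩
  | @head x x' h _ ih =>
    obtain ⟨L, c, h0, hL, hs⟩ := ih
    refine ⟨L + 1, fun i => Nat.casesOn i x c, rfl, hL, fun i hi => ?_⟩
    cases i with
    | zero => change GoodStep k x (c 0); rwa [h0]
    | succ i => exact hs i (by omega)

/-- Every good step on a path of good steps from the minimum to the maximum is an edge of the
poset. -/
theorem exists_mem_chainsPF {n k : ℕ} {x y : NC (n + 1)} (hx : GoodLE k ⊥ x)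
    (hxy : GoodStep k x y) (hy : GoodLE k y ⊤) :
    ∃ c ∈ chainsPF n k, ∃ i : Fin n, c i.castSucc = x ∧ c i.succ = y := by
  obtain ⟨p, c₁, h10, h1p, h1⟩ := hx.exists_path
  obtain ⟨q, c₂, h20, h2q, h2⟩ := hy.exists_path
  let C : ℕ → NC (n + 1) := fun i => if i ≤ p then c₁ i else c₂ (i - (p + 1))
  have hCle : ∀ i ≤ p, C i = c₁ i := fun i hi => if_pos hi
  have hCgt : ∀ i, C (p + 1 + i) = c₂ i := fun i =>
    (if_neg (by omega)).trans (congrArg c₂ (by omega))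
  have hC0 : C 0 = ⊥ := (hCle 0 (Nat.zero_le p)).trans h10
  have hCp : C p = x := (hCle p le_rfl).trans h1p
  have hCp1 : C (p + 1) = y := (hCgt 0).trans h20
  have hCtop : C (p + 1 + q) = ⊤ := (hCgt q).trans h2q
  have hstep : ∀ i < p + 1 + q, GoodStep k (C i) (C (i + 1)) := by
    intro i hi
    rcases lt_trichotomy i p with h | rfl | h
    · rw [hCle i h.le, hCle (i + 1) h]; exact h1 i h
    · rw [hCp, hCp1]; exact hxy
    · obtain ⟨j, rfl⟩ := Nat.exists_eq_add_of_le (Nat.succ_le_of_lt h)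
      rw [Nat.succ_eq_add_one, hCgt j, show p + 1 + j + 1 = p + 1 + (j + 1) by omega, hCgt (j + 1)]
      exact h2 j (by omega)
  -- The number of classes drops by one in each step, so the path has `n` steps.
  have hrank : ∀ i ≤ p + 1 + q, (blockMins 0 (C i)).card + i = n + 1 := by
    intro i
    induction i with
    | zero => intro _; rw [hC0, card_blockMins_bot (Nat.zero_le n)]; rfl
    | succ i ih =>
      intro hi
      classical
      obtain ⟨u, v, hg, hm⟩ := hstep i (by omega)
      have := card_blockMins_step (j := 0) hg.not_rel hm
      rw [if_pos ((joins_iff hg.not_rel hm).2 ⟨u, v, (C i).1.refl u, (C i).1.refl v,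
        Nat.zero_le _, Nat.zero_le _⟩)] at this
      have := ih (by omega)
      omega
  have hlen : p + 1 + q = n := by
    have := hrank _ le_rfl
    rw [hCtop, card_blockMins_top (Nat.zero_le n)] at this
    omega
  refine ⟨fun i => C i, mem_chainsPF_of_goodStep hC0 ?_ fun i => ?_, ⟨p, by omega⟩, hCp, hCp1⟩
  · simp only [Fin.val_last]
    rw [← hCtop, hlen]
  · exact hstep i (by omega)

end Labels

/-! ### A path of good steps from the minimum to the maximum -/

/-- The partition whose only class that need not be a singleton is `S`. -/
def singleBlock {m : ℕ} (S : Set (Fin m)) : NC m :=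
  ⟨{ r a b := a = b ∨ (a ∈ S ∧ b ∈ S)
     iseqv :=
      { refl _ := Or.inl rfl
        symm h := h.imp Eq.symm And.symm
        trans := by
          rintro a b c (rfl | h) (rfl | h')
          exacts [Or.inl rfl, Or.inr h', Or.inr h, Or.inr ⟨h.1, h'.2⟩] } },
    fun a b c d hab hbc hcd hac hbd => by
      rcases hac with rfl | hac
      · exact absurd (hab.trans hbc) (lt_irrefl _)
      rcases hbd with rfl | hbd
      · exact absurd (hbc.trans hcd) (lt_irrefl _)
      exact Or.inr ⟨hac.1, hbd.1⟩⟩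

section SingleBlock

variable {m : ℕ} {S : Set (Fin m)}

theorem singleBlock_rel {a b : Fin m} : (singleBlock S).1 a b ↔ a = b ∨ (a ∈ S ∧ b ∈ S) := Iff.rfl

theorem singleBlock_rel_mem {a s : Fin m} (hs : s ∈ S) : (singleBlock S).1 a s ↔ a ∈ S := by
  rw [singleBlock_rel]
  exact ⟨fun h => h.elim (fun h => h ▸ hs) And.left, fun h => Or.inr ⟨h, hs⟩⟩

theorem singleBlock_rel_notMem {a w : Fin m} (hw : w ∉ S) : (singleBlock S).1 a w ↔ a = w := by
  rw [singleBlock_rel]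
  exact ⟨fun h => h.elim id fun h => absurd h.2 hw, Or.inl⟩

theorem singleBlock_insert {s w : Fin m} (hs : s ∈ S) (hw : w ∉ S) :
    (singleBlock (insert w S)).1 = (singleBlock S).1.mergeClasses s w := by
  refine Setoid.ext fun a b => ?_
  rw [Setoid.mergeClasses_apply, singleBlock_rel_mem hs, singleBlock_rel_mem hs,
    singleBlock_rel_notMem hw, singleBlock_rel_notMem hw, singleBlock_rel, singleBlock_rel,
    Set.mem_insert_iff, Set.mem_insert_iff]
  tauto

theorem singleBlock_eq_bot {s : Fin m} (h : ∀ a ∈ S, a = s) : singleBlock S = ⊥ :=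
  Subtype.ext (Setoid.ext fun a b =>
    ⟨fun hab => hab.elim id fun hab => (h a hab.1).trans (h b hab.2).symm, Or.inl⟩)

theorem singleBlock_eq_top (h : ∀ a, a ∈ S) : singleBlock S = ⊤ :=
  Subtype.ext (Setoid.ext fun a b => ⟨fun _ => trivial, fun _ => Or.inr ⟨h a, h b⟩⟩)

end SingleBlock

/-- The numbers above `k` are collected in a block from right to left; `1, 2, …, k` are then added
to it in this order. -/
theorem goodLE_bot_top {n k : ℕ} (hk : 2 ≤ k) (hkn : k ≤ n) :
    GoodLE k (⊥ : NC (n + 1)) ⊤ := by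
  have upper : ∀ d ≤ n - k, GoodLE k (⊥ : NC (n + 1)) (singleBlock {a | n - d ≤ (a : ℕ)}) := by
    intro d
    induction d with
    | zero =>
      intro _
      rw [singleBlock_eq_bot (S := {a : Fin (n + 1) | n - 0 ≤ (a : ℕ)}) (s := Fin.last n) fun a ha =>
        Fin.ext (by have h : n - 0 ≤ (a : ℕ) := ha; have := a.2; simp only [Fin.val_last]; omega)]
    | succ d ih =>
      intro hd
      refine (ih (by omega)).tail ?_
      set S : Set (Fin (n + 1)) := {a | n - d ≤ (a : ℕ)}
      have hS' : ∀ a, a ∈ S ↔ n - d ≤ (a : ℕ) := fun a => Iff.rfl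
      have hs : Fin.last n ∈ S := (hS' _).2 (by simp)
      let w : Fin (n + 1) := ⟨n - (d + 1), by omega⟩
      have hwv : (w : ℕ) = n - (d + 1) := rfl
      have hw : w ∉ S := by rw [hS']; omega
      have heq : {a : Fin (n + 1) | n - (d + 1) ≤ (a : ℕ)} = insert w S := by
        ext a
        rw [Set.mem_insert_iff, hS', Set.mem_ofPred_eq, Fin.ext_iff]
        omega
      rw [heq]
      refine ⟨w, Fin.last n, ⟨?_, ⟨w, Setoid.refl' _ w, ?_⟩, ?_, ?_⟩,
        (singleBlock_insert hs hw).trans (Setoid.mergeClasses_comm _ _ _)⟩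
      all_goals simp only [singleBlock_rel_mem hs, singleBlock_rel_notMem hw, hS', Fin.lt_def]
      · omega
      · intro b hb; omega
      · rintro e rfl he; omega
      · rintro a b - - - - a' b' rfl hb'; omega
  have lower : ∀ j ≤ k,
      GoodLE k (⊥ : NC (n + 1)) (singleBlock {a | (a : ℕ) < j ∨ k ≤ (a : ℕ)}) := by
    intro j
    induction j with
    | zero =>
      intro _
      have := upper (n - k) le_rfl
      rw [show n - (n - k) = k by omega] at this
      simpa using this
    | succ j ih =>
      intro hj
      refine (ih (by omega)).tail ?_
      set S : Set (Fin (n + 1)) := {a | (a : ℕ) < j ∨ k ≤ (a : ℕ)}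
      have hS' : ∀ a, a ∈ S ↔ ((a : ℕ) < j ∨ k ≤ (a : ℕ)) := fun a => Iff.rfl
      have hs : Fin.last n ∈ S := (hS' _).2 (by simp [hkn])
      let w : Fin (n + 1) := ⟨j, by omega⟩
      have hwv : (w : ℕ) = j := rfl
      have hw : w ∉ S := by rw [hS']; omega
      have heq : {a : Fin (n + 1) | (a : ℕ) < j + 1 ∨ k ≤ (a : ℕ)} = insert w S := by
        ext a
        rw [Set.mem_insert_iff, hS', Set.mem_ofPred_eq, Fin.ext_iff]
        omega
      rw [heq]
      rcases Nat.eq_zero_or_pos j with rfl | hj0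
      · -- The number `1` is below the block, so it is on the lower side.
        refine ⟨w, Fin.last n, ⟨?_, ⟨w, Setoid.refl' _ w, ?_⟩, ?_, ?_⟩,
          (singleBlock_insert hs hw).trans (Setoid.mergeClasses_comm _ _ _)⟩
        all_goals simp only [singleBlock_rel_mem hs, singleBlock_rel_notMem hw, hS', Fin.lt_def]
        · omega
        · intro b hb; omega
        · rintro e rfl he; omega
        · rintro a b rfl - ha; omega
      · refine ⟨Fin.last n, w, ⟨?_, ⟨0, ?_, ?_⟩, ?_, ?_⟩, singleBlock_insert hs hw⟩
        all_goals simp only [singleBlock_rel_mem hs, singleBlock_rel_notMem hw, hS', Fin.lt_def]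
        · intro h
          have := congrArg Fin.val h
          simp only [Fin.val_last] at this
          omega
        · exact Or.inl hj0
        · rintro b rfl; exact hj0
        · intro e _ _ h
          have := h w rfl
          omega
        · rintro a b - rfl - hb; omega
  rw [← singleBlock_eq_top (S := {a : Fin (n + 1) | (a : ℕ) < k ∨ k ≤ (a : ℕ)})
    fun a => lt_or_ge _ _]
  exact lower k le_rfl

/-! ### The poset as the set of partitions on paths of good steps -/

namespace PosetPF

variable {n k : ℕ}

theorem edge_of_goodStep {x y : PosetPF n k} (hx : GoodLE k ⊥ x.1) (h : GoodStep k x.1 y.1)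
    (hy : GoodLE k y.1 ⊤) : Edge x y := exists_mem_chainsPF hx h hy

theorem goodStep_of_edge {x y : PosetPF n k} (h : Edge x y) : GoodStep k x.1 y.1 := by
  obtain ⟨c, hc, i, h1, h2⟩ := h
  rw [← h1, ← h2]
  exact goodStep_of_mem_chainsPF hc i

theorem goodLE_of_le {x y : PosetPF n k} (h : x ≤ y) : GoodLE k x.1 y.1 :=
  Relation.ReflTransGen.lift (r := Edge) Subtype.val (fun _ _ => goodStep_of_edge) _ _ h

theorem goodLE_bot (x : PosetPF n k) : GoodLE k ⊥ x.1 := by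
  obtain ⟨π, c, hc, i, rfl⟩ := x
  change GoodLE k ⊥ (c i)
  induction i using Fin.induction with
  | zero => rw [hc.1.1]
  | succ i ih => exact ih.tail (goodStep_of_mem_chainsPF hc i)

theorem goodLE_top (x : PosetPF n k) : GoodLE k x.1 ⊤ := by
  obtain ⟨π, c, hc, i, rfl⟩ := x
  change GoodLE k (c i) ⊤
  induction i using Fin.reverseInduction with
  | last => rw [hc.1.2.1]
  | cast i ih => exact Relation.ReflTransGen.head (goodStep_of_mem_chainsPF hc i) ih

theorem exists_mem_of_goodLE (hn : 1 ≤ n) {z : NC (n + 1)} (h : GoodLE k ⊥ z)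
    (h' : GoodLE k z ⊤) : ∃ c ∈ chainsPF n k, ∃ i, c i = z := by
  rcases Relation.ReflTransGen.cases_head h' with rfl | ⟨w, hw, hw'⟩
  · rcases Relation.ReflTransGen.cases_tail h with h0 | ⟨w, hw, hw'⟩
    · have h01 : (⊤ : NC (n + 1)).1 0 (Fin.last n) := trivial
      rw [h0] at h01
      have := congrArg Fin.val (show (0 : Fin (n + 1)) = Fin.last n from h01)
      simp only [Fin.val_zero, Fin.val_last] at this
      omega
    · obtain ⟨c, hc, i, -, hi⟩ := exists_mem_chainsPF hw hw' Relation.ReflTransGen.refl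
      exact ⟨c, hc, _, hi⟩
  · obtain ⟨c, hc, i, hi, -⟩ := exists_mem_chainsPF h hw hw'
    exact ⟨c, hc, _, hi⟩

theorem le_of_goodLE (hn : 1 ≤ n) {x y : PosetPF n k} (h : GoodLE k x.1 y.1) : x ≤ y := by
  obtain ⟨x, hx⟩ := x
  have hbot : GoodLE k ⊥ x := goodLE_bot ⟨x, hx⟩
  change GoodLE k x y.1 at h
  induction h using Relation.ReflTransGen.head_induction_on with
  | refl => exact le_rfl
  | @head x x' hs h' ih =>
    have hbot' := hbot.tail hs
    have htop' := h'.trans (goodLE_top y)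
    have hx' := exists_mem_of_goodLE hn hbot' htop'
    exact le_trans (Relation.ReflTransGen.single
      (edge_of_goodStep (x := ⟨x, hx⟩) (y := ⟨x', hx'⟩) hbot hs htop')) (ih hx' hbot')

/-- The Möbius function vanishes at every element that joins the number `k` to a larger number. -/
theorem mu_eq_zero (hn : 1 ≤ n) {b : PosetPF n k} (hb : b.1 = ⊥) (hb' : IsBot b) (e : Fin (n + 1))
    (he : (e : ℕ) + 1 = k) (y : PosetPF n k) (t : Fin (n + 1)) (ht : k ≤ (t : ℕ))
    (hte : y.1.1 t e) : IncidenceAlgebra.mu ℤ b y = 0 := by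
  induction y using WellFoundedLT.induction generalizing t with
  | ind y ih =>
    obtain ⟨p, q, H⟩ := exists_isPivot he ht hte
    have hcy : H.closure Relation.ReflTransGen.refl = y.1 := H.closure_eq_self _ H.rel_pq
    have hcley : ∀ {x : NC (n + 1)} (hx : GoodLE k x y.1), GoodLE k (H.closure hx) y.1 :=
      fun hx => by
        have := H.closure_mono hx Relation.ReflTransGen.refl hx
        rwa [hcy] at this
    classical
    -- Outside the interval below `y` the value of `f` does not matter.
    let f : PosetPF n k → PosetPF n k := fun x =>
      if hx : x ≤ y then
        ⟨H.closure (goodLE_of_le hx), exists_mem_of_goodLE hn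
          ((goodLE_bot x).trans (H.goodLE_closure _)) ((hcley _).trans (goodLE_top y))⟩
      else x
    have hf : ∀ {x} (hx : x ≤ y), (f x).1 = H.closure (goodLE_of_le hx) := fun hx =>
      congrArg Subtype.val (dif_pos hx)
    have hfy : ∀ {x}, x ≤ y → f x ≤ y := fun hx =>
      le_of_goodLE hn (by rw [hf hx]; exact hcley _)
    have hself : ∀ {x}, x ≤ y → x.1.1 p q → f x = x := fun hx hpq =>
      Subtype.ext ((hf hx).trans (H.closure_eq_self _ hpq))
    have hpair : ∀ {x}, x ≤ y → (f x).1.1 p q := fun {x} hx => by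
      rw [hf hx]; exact x.1.1.mergeClasses_pair p q
    refine mu_eq_zero_of_closure hb' f ?_ ?_ ?_ ?_ ?_ ?_
    · exact fun x hx => le_of_goodLE hn (by rw [hf hx]; exact H.goodLE_closure _)
    · intro x x' hxx' hx'
      refine le_of_goodLE hn ?_
      rw [hf hx', hf (hxx'.trans hx')]
      exact H.closure_mono _ _ (goodLE_of_le hxx')
    · exact fun x hx => hself (hfy hx) (hpair hx)
    · exact hself le_rfl H.rel_pq
    · intro hfb
      have hpq := hpair (hb' y)
      rw [hfb, hb] at hpq
      exact H.p_lt_q.ne hpq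
    · intro x hx hxy hfx
      refine ih x (lt_of_le_of_ne hx hxy) q H.k_le ?_
      exact H.rel_qe_of_closure_eq (goodLE_of_le hx) (fun h => hxy (Subtype.ext h))
        ((hf hx).symm.trans (congrArg Subtype.val hfx))

end PosetPF

theorem theoremC (n k : ℕ) (hk : 2 ≤ k) (hkn : k ≤ n) :
    ∃ x y : PosetPF n k, x.1 = ⊥ ∧ y.1 = ⊤ ∧ IsBot x ∧ IsTop y ∧
      IncidenceAlgebra.mu ℤ x y = 0 := by
  have hn : 1 ≤ n := by omega
  have h := goodLE_bot_top hk hkn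
  let x : PosetPF n k := ⟨⊥, PosetPF.exists_mem_of_goodLE hn Relation.ReflTransGen.refl h⟩
  let y : PosetPF n k := ⟨⊤, PosetPF.exists_mem_of_goodLE hn h Relation.ReflTransGen.refl⟩
  have hx : IsBot x := fun z => PosetPF.le_of_goodLE hn z.goodLE_bot
  refine ⟨x, y, rfl, rfl, hx, fun z => PosetPF.le_of_goodLE hn z.goodLE_top, ?_⟩
  exact PosetPF.mu_eq_zero hn rfl hx ⟨k - 1, by omega⟩ (by simp only; omega) y (Fin.last n)
    (by simpa using hkn) trivial
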